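/- \textbf{Definitions.} A $\Delta$-complex $K$ consists of sets $K_n$ ($n\ge 0$) of $n$-cells and faces $d_i\colon K_n\to K_{n-1}$ ($n\ge 1$, $0\le i\le n$) with $d_jd_l=d_{l-1}d_j$ for $j\le l-1$; its boundary maps are $\partial_n x=\sum_{i=0}^n(-1)^id_ix$ on the free abelian groups generated by the $K_n$. The edges of a 2-cell are its faces, the vertices of a 1-cell are its faces, and the vertices of a 2-cell are the faces of its faces. An $\mathcal M$-complex is a connected $\Delta$-complex such that: (0) it has finitely many cells; (1) it has no $m$-cells for $m\ge 3$, every 0-cell is a face of a 1-cell and every 1-cell is a face of a 2-cell; (2) different faces of a 2-cell are different 1-cells, and different faces of a 1-cell are different 0-cells; (3) every 1-cell is an edge of exactly two 2-cells; (4) for every 0-cell $w$, any two 2-cells having $w$ as a vertex are joined by a sequence of 2-cells in which any two consecutive members share an edge having $w$ as a vertex; (5) $\ker\partial_2\cong\mathbf Z$. An $\mathcal M$-complex is an \emph{identity} if it has exactly two 2-cells $u\ne v$ and $d_iu=d_iv$ for $i=0,1,2$; otherwise it is \emph{proper}. For 2-dimensional $\Delta$-complexes $X$, $Y$ with disjoint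 sets of cells, $x\in X_2$ and $y\in Y_2$, the \emph{connected sum} $X\,{}_x\!\circ_y Y$ has $(X_2-\{x\})\cup(Y_2-\{y\})$ as its set of 2-cells; its 1-cells (0-cells) are obtained from $X_1\cup Y_1$ ($X_0\cup Y_0$) by identifying $d_ix$ with $d_iy$ ($d_id_jx$ with $d_id_jy$) for all $i$ (for all $i,j$), and its faces are induced by those of $X$ and $Y$. An $\mathcal M$-complex is \emph{decomposable} if it is isomorphic to a connected sum of two proper $\mathcal M$-complexes. A \emph{cut-triangle} of an $\mathcal M$-complex $K$ is a set $T=\{e_0,e_1,e_2\}\subseteq K_1$ such that $\partial_1(e_0-e_1+e_2)=0$ and the transitive closure of the relation ``$u$ and $v$ share an edge belonging to $K_1-T$'' on $K_2$ is an equivalence relation with exactly two classes. $K$ is \emph{reducible} if it has a cut-triangle. \textbf{Proposition.} An $\mathcal M$-complex is reducible if and only if it is decomposable. -/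

import Mathlib

universe u

/-- An (abstract) `Δ`-complex: sets `K_0, K_1, …` of cells and faces `d_i : K_{n+1} → K_n`,
`0 ≤ i ≤ n + 1`, with `d_i d_{j+1} = d_j d_i` for `i ≤ j`. -/
structure DeltaComplex where
  cell : ℕ → Type u
  face : {n : ℕ} → Fin (n + 2) → cell (n + 1) → cell n
  face_face : ∀ {n : ℕ} (i j : Fin (n + 2)), i ≤ j → ∀ x : cell (n + 2),
    face i (face j.succ x) = face j (face i.castSucc x)

namespace DeltaComplex

/-- A morphism of `Δ`-complexes: functions on cells that commute with the faces. -/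
structure Hom (K L : DeltaComplex.{u}) where
  map : (n : ℕ) → K.cell n → L.cell n
  map_face : ∀ (n : ℕ) (i : Fin (n + 2)) (x : K.cell (n + 1)),
    map n (K.face i x) = L.face i (map (n + 1) x)

/-- `K` and `L` are isomorphic: there is a morphism all of whose components are bijections. -/
def Isomorphic (K L : DeltaComplex.{u}) : Prop :=
  ∃ f : Hom K L, ∀ n, Function.Bijective (f.map n)

section Axioms

variable (K : DeltaComplex.{u})

/-- `e` is an edge of the 2-cell `x`. -/
def IsEdge (e : K.cell 1) (x : K.cell 2) : Prop := ∃ i, K.face i x = e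

/-- `w` is a vertex of the 1-cell `e`. -/
def IsVertexOfEdge (w : K.cell 0) (e : K.cell 1) : Prop := ∃ i, K.face i e = w

/-- `w` is a vertex of the 2-cell `x`: a face of a face of `x`. -/
def IsVertex (w : K.cell 0) (x : K.cell 2) : Prop := ∃ e, K.IsEdge e x ∧ K.IsVertexOfEdge w e

/-- The boundary `∂₁ : C_1 → C_0`, `∂₁ e = d_0 e - d_1 e`, where `C_n` is the free abelian group
on the `n`-cells. -/
noncomputable def boundaryOne : (K.cell 1 →₀ ℤ) →ₗ[ℤ] (K.cell 0 →₀ ℤ) :=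
  Finsupp.linearCombination ℤ fun e : K.cell 1 =>
    Finsupp.single (K.face 0 e) (1 : ℤ) - Finsupp.single (K.face 1 e) 1

/-- The boundary `∂₂ : C_2 → C_1`, `∂₂ x = d_0 x - d_1 x + d_2 x`. -/
noncomputable def boundaryTwo : (K.cell 2 →₀ ℤ) →ₗ[ℤ] (K.cell 1 →₀ ℤ) :=
  Finsupp.linearCombination ℤ fun x : K.cell 2 =>
    Finsupp.single (K.face 0 x) (1 : ℤ) - Finsupp.single (K.face 1 x) 1
      + Finsupp.single (K.face 2 x) 1

/-- Two 0-cells are the pair of vertices of some 1-cell. -/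
def Adjacent (w w' : K.cell 0) : Prop :=
  ∃ e : K.cell 1, (K.face 0 e = w ∧ K.face 1 e = w') ∨ (K.face 0 e = w' ∧ K.face 1 e = w)

/-- Two 2-cells share an edge having `w` as a vertex. -/
def Neighbours (w : K.cell 0) (x x' : K.cell 2) : Prop :=
  ∃ e, K.IsVertexOfEdge w e ∧ K.IsEdge e x ∧ K.IsEdge e x'

/-- `M`-complexes. -/
structure IsMComplex : Prop where
  connected : ∀ w w' : K.cell 0, Relation.ReflTransGen K.Adjacent w w'
  finite : Finite (Σ n, K.cell n)
  /-- Homogeneous of dimension 2. -/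
  empty_of_three_le : ∀ m, 3 ≤ m → IsEmpty (K.cell m)
  exists_edge : ∀ w : K.cell 0, ∃ e, K.IsVertexOfEdge w e
  exists_triangle : ∀ e : K.cell 1, ∃ x, K.IsEdge e x
  /-- Regular: different faces map a cell to different cells. -/
  regular_two : ∀ x : K.cell 2, Function.Injective fun i => K.face i x
  regular_one : ∀ e : K.cell 1, Function.Injective fun i => K.face i e
  /-- Every 1-cell is an edge of exactly two 2-cells. -/
  two_triangles : ∀ e : K.cell 1, {x | K.IsEdge e x}.ncard = 2
  /-- The 2-cells around a 0-cell are linked. -/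
  linked : ∀ (w : K.cell 0) (x x' : K.cell 2), K.IsVertex w x → K.IsVertex w x' →
    Relation.ReflTransGen (K.Neighbours w) x x'
  /-- Orientable: the second homology group is infinite cyclic. As there are no 3-cells, this
  group is the group of 2-cycles. In particular, the complex is not empty. -/
  orientable : Nonempty (LinearMap.ker (K.boundaryTwo) ≃ₗ[ℤ] ℤ)

/-- The identities (units): complexes given by two 2-cells with the same boundaries. -/
def IsIdentity : Prop :=
  ∃ x x' : K.cell 2, x ≠ x' ∧ (∀ z, z = x ∨ z = x') ∧ ∀ i, K.face i x = K.face i x'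

/-- A proper `M`-complex is one that is not an identity. -/
def IsProperMComplex : Prop := K.IsMComplex ∧ ¬ K.IsIdentity

/-- Two 2-cells share an edge that does not belong to `T`. -/
def SharesEdgeOff (T : Set (K.cell 1)) (x x' : K.cell 2) : Prop :=
  ∃ e, e ∉ T ∧ K.IsEdge e x ∧ K.IsEdge e x'

/-- `T = {e₀, e₁, e₂}` is a cut-triangle: `e₀ - e₁ + e₂` is a 1-cycle, and the transitive closure
of the relation of sharing an edge outside `T` is an equivalence relation on the 2-cells with
exactly two classes. -/
def IsCutTriangle (T : Set (K.cell 1)) : Prop :=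
  (∃ e₀ e₁ e₂ : K.cell 1, T = {e₀, e₁, e₂} ∧
    K.boundaryOne (Finsupp.single e₀ 1 - Finsupp.single e₁ 1 + Finsupp.single e₂ 1) = 0) ∧
  ∃ h : Equivalence (Relation.TransGen (K.SharesEdgeOff T)),
    Nat.card (Quotient (Setoid.mk (Relation.TransGen (K.SharesEdgeOff T)) h)) = 2

/-- `K` has a cut-triangle. -/
def IsReducible : Prop := ∃ T, K.IsCutTriangle T

end Axioms

section ConnectedSum

variable (X Y : DeltaComplex.{u}) (x : X.cell 2) (y : Y.cell 2)

/-- The `i`-th edge of `x` is identified with the `i`-th edge of `y`. -/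
inductive EdgeGlue : X.cell 1 ⊕ Y.cell 1 → X.cell 1 ⊕ Y.cell 1 → Prop
  | mk (i : Fin 3) : EdgeGlue (Sum.inl (X.face i x)) (Sum.inr (Y.face i y))

/-- The vertices of `x` are identified with the corresponding vertices of `y`. -/
inductive VertexGlue : X.cell 0 ⊕ Y.cell 0 → X.cell 0 ⊕ Y.cell 0 → Prop
  | mk (i : Fin 2) (j : Fin 3) :
      VertexGlue (Sum.inl (X.face i (X.face j x))) (Sum.inr (Y.face i (Y.face j y)))

/-- The cells of the connected sum: `x` and `y` are deleted, and their boundaries are glued.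
`Quot r` is the quotient by the equivalence relation generated by `r`. -/
def SumCell : ℕ → Type u
  | 0 => Quot (VertexGlue X Y x y)
  | 1 => Quot (EdgeGlue X Y x y)
  | 2 => {z : X.cell 2 // z ≠ x} ⊕ {z : Y.cell 2 // z ≠ y}
  | _ + 3 => PEmpty

/-- The faces of the connected sum, induced by those of `X` and `Y`. -/
def sumFace : {n : ℕ} → Fin (n + 2) → SumCell X Y x y (n + 1) → SumCell X Y x y n
  | 0, i, c => Quot.map (Sum.map (X.face i) (Y.face i))
      (fun _ _ h => by cases h with | mk j => exact VertexGlue.mk i j) c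
  | 1, i, c => Quot.mk _ (Sum.map (fun z => X.face i z.1) (fun z => Y.face i z.1) c)
  | _ + 2, _, c => PEmpty.elim c

/-- The connected sum of 2-dimensional complexes `X` and `Y` with respect to `x` and `y`. -/
def connectedSum : DeltaComplex.{u} where
  cell := SumCell X Y x y
  face := sumFace X Y x y
  face_face := by
    intro n i j hij c
    match n, i, j, hij, c with
    | 0, i, j, hij, Sum.inl z =>
      exact congrArg (fun w => Quot.mk (VertexGlue X Y x y) (Sum.inl w)) (X.face_face i j hij z.1)
    | 0, i, j, hij, Sum.inr z =>
      exact congrArg (fun w => Quot.mk (VertexGlue X Y x y) (Sum.inr w)) (Y.face_face i j hij z.1)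
    | _ + 1, _, _, _, c => exact PEmpty.elim c

end ConnectedSum

/-- `K` is, up to isomorphism (that is, up to the names of the cells), a connected sum of two
proper `M`-complexes. -/
def IsDecomposable (K : DeltaComplex.{u}) : Prop :=
  ∃ (X Y : DeltaComplex.{u}) (x : X.cell 2) (y : Y.cell 2),
    X.IsProperMComplex ∧ Y.IsProperMComplex ∧ K.Isomorphic (connectedSum X Y x y)

end DeltaComplex

/-! Everything rests on restricting a nonzero 2-cycle `c` to a set `C` of 2-cells whose frontier
lies in a triangle. The boundary of the restriction is then a 1-cycle carried by three 1-cells,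
hence `k` times the triangle (`exists_smul_eq_boundaryTwo_filter`). By strong connectedness a
2-cycle vanishing at one 2-cell is zero (`StronglyConnected.eq_zero`), and this controls `k`.

Decomposable implies reducible: the cut-triangle is the glued boundary of `x` and `y`. Only its
edges are shared by the two sides. Each side is linked off the triangle: a part of `X` cut off by
the boundary of `x`, corrected by a multiple of `x`, carries a 2-cycle, so it contains every 2-cell
but `x` (`IsMComplex.mem_of_frontier_subset`). Properness gives every 2-cell an edge off the
triangle, which makes the transitive closure reflexive.

Reducible implies decomposable: let `A` be a class of 2-cells, and cap `A` and its complement by a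
new 2-cell along the triangle. Sending all 2-cells outside `A` to the new one transfers the
incidence axioms from `K` to the cap. Orientability holds because `c` restricted to `A`, minus `k`
times the new cell, is a cycle, with `k ≠ 0`. Gluing the two caps gives back `K`; on vertices this
uses the linking axiom. -/

theorem Relation.ReflTransGen.exists_crossing {α : Type*} {r : α → α → Prop} {a b : α}
    (h : Relation.ReflTransGen r a b) {A : Set α} (ha : a ∈ A) (hb : b ∉ A) :
    ∃ s t, s ∈ A ∧ t ∉ A ∧ r s t := by
  induction h with
  | refl => exact absurd ha hb
  | @tail s t _ hst ih =>
    by_cases hs : s ∈ A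
    · exact ⟨s, t, hs, hb, hst⟩
    · exact ih hs

/-- The image is a nonzero principal ideal of `ℤ`, hence free of rank one. -/
theorem LinearMap.nonempty_equiv_int_of_injective {M : Type*} [AddCommGroup M]
    (f : M →ₗ[ℤ] ℤ) (hf : Function.Injective f) {m : M} (hm : m ≠ 0) :
    Nonempty (M ≃ₗ[ℤ] ℤ) := by
  obtain ⟨g, hg⟩ := (IsPrincipalIdealRing.principal (LinearMap.range f)).principal
  have hg0 : g ≠ 0 := by
    rintro rfl
    have h : f m ∈ LinearMap.range f := ⟨m, rfl⟩
    rw [hg] at h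
    exact hm (hf (by simpa using h))
  exact ⟨(LinearEquiv.ofInjective f hf).trans ((LinearEquiv.ofEq _ _ hg).trans
    (LinearEquiv.toSpanNonzeroSingleton ℤ ℤ g hg0).symm)⟩

namespace DeltaComplex

theorem Isomorphic.symm {K L : DeltaComplex.{u}} (h : K.Isomorphic L) : L.Isomorphic K := by
  obtain ⟨f, hf⟩ := h
  refine ⟨⟨fun n => (Equiv.ofBijective _ (hf n)).symm, fun n i x => ?_⟩,
    fun n => (Equiv.ofBijective _ (hf n)).symm.bijective⟩
  rw [Equiv.symm_apply_eq]
  change _ = f.map n _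
  rw [f.map_face]
  exact congrArg _ ((Equiv.ofBijective _ (hf (n + 1))).apply_symm_apply x).symm

/-! ### Triangles of 1-cells -/

variable {K : DeltaComplex.{u}}

/-- The 1-cells `e 0, e 1, e 2` fit together like the faces of a 2-cell. -/
structure IsTriangle (K : DeltaComplex.{u}) (e : Fin 3 → K.cell 1) : Prop where
  face_zero_one : K.face 0 (e 1) = K.face 0 (e 0)
  face_zero_two : K.face 0 (e 2) = K.face 1 (e 0)
  face_one_two : K.face 1 (e 2) = K.face 1 (e 1)

/-- The 1-chain `e 0 - e 1 + e 2`. -/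
noncomputable def triangleChain (K : DeltaComplex.{u}) (e : Fin 3 → K.cell 1) :
    K.cell 1 →₀ ℤ :=
  Finsupp.single (e 0) 1 - Finsupp.single (e 1) 1 + Finsupp.single (e 2) 1

/-- The faces of a 2-cell. -/
def edges (K : DeltaComplex.{u}) (x : K.cell 2) (i : Fin 3) : K.cell 1 := K.face i x

theorem isEdge_iff {f : K.cell 1} {x : K.cell 2} : K.IsEdge f x ↔ f ∈ Set.range (K.edges x) :=
  Iff.rfl

theorem isTriangle_edges (x : K.cell 2) : K.IsTriangle (K.edges x) where
  face_zero_one := K.face_face 0 0 le_rfl x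
  face_zero_two := K.face_face 0 1 (by simp) x
  face_one_two := K.face_face 1 1 le_rfl x

theorem IsTriangle.face_face {e : Fin 3 → K.cell 1} (he : K.IsTriangle e) (i j : Fin 2)
    (hij : i ≤ j) : K.face i (e j.succ) = K.face j (e i.castSucc) := by
  fin_cases i <;> fin_cases j
  · exact he.face_zero_one
  · exact he.face_zero_two
  · exact absurd hij (by decide)
  · exact he.face_one_two

theorem face_ne (h1 : ∀ e : K.cell 1, Function.Injective fun i => K.face i e) (e : K.cell 1) :
    K.face 0 e ≠ K.face 1 e :=
  fun h => absurd (h1 e h) (by decide)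

/-- If two of the 1-cells coincided, the incidences would give a 1-cell with equal faces. -/
theorem IsTriangle.ne (h1 : ∀ e : K.cell 1, Function.Injective fun i => K.face i e)
    {e : Fin 3 → K.cell 1} (he : K.IsTriangle e) : e 0 ≠ e 1 ∧ e 0 ≠ e 2 ∧ e 1 ≠ e 2 := by
  have a := he.face_zero_one
  have b := he.face_zero_two
  have c := he.face_one_two
  have n0 := face_ne h1 (e 0)
  have n1 := face_ne h1 (e 1)
  have n2 := face_ne h1 (e 2)
  clear h1
  refine ⟨fun h => ?_, fun h => ?_, fun h => ?_⟩ <;> grind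

theorem IsTriangle.injective (h1 : ∀ e : K.cell 1, Function.Injective fun i => K.face i e)
    {e : Fin 3 → K.cell 1} (he : K.IsTriangle e) : Function.Injective e := by
  obtain ⟨a, b, c⟩ := he.ne h1
  intro i j h
  fin_cases i <;> fin_cases j <;> simp_all

/-- The faces order the three vertices linearly, and this order tells the three 1-cells apart. So a
triangle is determined by its set of 1-cells. -/
theorem IsTriangle.eq_of_forall_mem_range
    (h1 : ∀ e : K.cell 1, Function.Injective fun i => K.face i e)
    {e e' : Fin 3 → K.cell 1} (he : K.IsTriangle e) (he' : K.IsTriangle e')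
    (h : ∀ i, e' i ∈ Set.range e) : e' = e := by
  obtain ⟨a, b, c⟩ := he.ne h1
  obtain ⟨a', b', c'⟩ := he'.ne h1
  have p := he.face_zero_one
  have q := he.face_zero_two
  have r := he.face_one_two
  have p' := he'.face_zero_one
  have q' := he'.face_zero_two
  have r' := he'.face_one_two
  have n0 := face_ne h1 (e 0)
  have n1 := face_ne h1 (e 1)
  have n2 := face_ne h1 (e 2)
  have m (i) : e' i = e 0 ∨ e' i = e 1 ∨ e' i = e 2 := by
    obtain ⟨j, hj⟩ := h i
    fin_cases j <;> simp_all
  have m0 := m 0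
  have m1 := m 1
  have m2 := m 2
  clear m h h1
  have : e' 0 = e 0 ∧ e' 1 = e 1 ∧ e' 2 = e 2 := by grind
  obtain ⟨x, y, z⟩ := this
  funext i
  fin_cases i <;> assumption

/-! ### Boundaries, and cycles carried by a triangle -/

theorem boundaryOne_single (f : K.cell 1) (k : ℤ) :
    K.boundaryOne (Finsupp.single f k) =
      k • (Finsupp.single (K.face 0 f) (1 : ℤ) - Finsupp.single (K.face 1 f) 1) :=
  Finsupp.linearCombination_single ..

theorem boundaryTwo_single (x : K.cell 2) (k : ℤ) :
    K.boundaryTwo (Finsupp.single x k) = k • K.triangleChain (K.edges x) :=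
  Finsupp.linearCombination_single ..

theorem IsTriangle.boundaryOne_triangleChain {e : Fin 3 → K.cell 1} (he : K.IsTriangle e) :
    K.boundaryOne (K.triangleChain e) = 0 := by
  simp only [triangleChain, map_add, map_sub, boundaryOne_single, one_smul, he.face_zero_one,
    he.face_zero_two, he.face_one_two]
  abel

theorem boundaryOne_boundaryTwo (c : K.cell 2 →₀ ℤ) : K.boundaryOne (K.boundaryTwo c) = 0 := by
  induction c using Finsupp.induction_linear with
  | zero => simp
  | add c d hc hd => simp [hc, hd]
  | single x k =>
    rw [boundaryTwo_single, map_smul, (isTriangle_edges x).boundaryOne_triangleChain, smul_zero]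

theorem triangleChain_apply_eq_zero {e : Fin 3 → K.cell 1} {f : K.cell 1}
    (hf : f ∉ Set.range e) : K.triangleChain e f = 0 := by
  have h (i) : e i ≠ f := fun h => hf ⟨i, h⟩
  simp [triangleChain, h]

theorem triangleChain_apply_eq {e : Fin 3 → K.cell 1} (he : Function.Injective e) (i : Fin 3) :
    K.triangleChain e (e i) = 1 ∨ K.triangleChain e (e i) = -1 := by
  fin_cases i <;> simp [triangleChain, he.eq_iff]

theorem IsTriangle.eq_smul_triangleChain
    (h1 : ∀ e : K.cell 1, Function.Injective fun i => K.face i e)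
    {e : Fin 3 → K.cell 1} (he : K.IsTriangle e) {z : K.cell 1 →₀ ℤ}
    (hz : ∀ f ∉ Set.range e, z f = 0) (hb : K.boundaryOne z = 0) :
    ∃ k : ℤ, z = k • K.triangleChain e := by
  classical
  obtain ⟨a, b, c⟩ := he.ne h1
  have hz' : z = Finsupp.single (e 0) (z (e 0)) + Finsupp.single (e 1) (z (e 1))
      + Finsupp.single (e 2) (z (e 2)) := by
    ext f
    by_cases hf : f ∈ Set.range e
    · obtain ⟨i, rfl⟩ := hf
      fin_cases i <;> simp [(he.injective h1).eq_iff]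
    · have h (i) : e i ≠ f := fun h => hf ⟨i, h⟩
      simp [hz f hf, h]
  have n0 := face_ne h1 (e 0)
  have n1 := face_ne h1 (e 1)
  have n2 := face_ne h1 (e 2)
  rw [he.face_zero_one] at n1
  rw [he.face_zero_two, he.face_one_two] at n2
  rw [hz'] at hb
  simp only [map_add, boundaryOne_single, he.face_zero_one,
    he.face_zero_two, he.face_one_two] at hb
  -- The vertex common to `e 0` and `e 1` and the one common to `e 1` and `e 2` give two equations,
  -- which leave one free coefficient.
  have u := DFunLike.congr_fun hb (K.face 0 (e 0))
  have v := DFunLike.congr_fun hb (K.face 1 (e 1))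
  simp [n0.symm, n1.symm] at u
  simp [n1, n2] at v
  refine ⟨z (e 0), hz'.trans ?_⟩
  have u' : z (e 1) = - z (e 0) := by linarith
  have v' : z (e 2) = z (e 0) := by linarith
  simp [triangleChain, u', v', smul_add, smul_sub, ← sub_eq_add_neg]

/-- The chain is symmetric in `e₀` and `e₂`, so the order of the triangle can be recovered only up
to exchanging them. -/
theorem isTriangle_or_of_boundaryOne_eq_zero
    (h1 : ∀ e : K.cell 1, Function.Injective fun i => K.face i e) {e₀ e₁ e₂ : K.cell 1}
    (h : K.boundaryOne
      (Finsupp.single e₀ 1 - Finsupp.single e₁ 1 + Finsupp.single e₂ 1) = 0) :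
    K.IsTriangle ![e₀, e₁, e₂] ∨ K.IsTriangle ![e₂, e₁, e₀] := by
  classical
  have n0 := face_ne h1 e₀
  have n1 := face_ne h1 e₁
  have n2 := face_ne h1 e₂
  simp only [map_add, map_sub, boundaryOne_single, one_smul] at h
  have key (w) := DFunLike.congr_fun h w
  simp only [Finsupp.add_apply, Finsupp.sub_apply, Finsupp.single_apply, Finsupp.zero_apply] at key
  have k1 := key (K.face 0 e₀)
  have k2 := key (K.face 1 e₀)
  have k3 := key (K.face 0 e₁)
  have k4 := key (K.face 1 e₁)
  have k5 := key (K.face 0 e₂)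
  have k6 := key (K.face 1 e₂)
  clear key h h1
  have : (K.face 0 e₁ = K.face 0 e₀ ∧ K.face 0 e₂ = K.face 1 e₀ ∧ K.face 1 e₂ = K.face 1 e₁) ∨
    (K.face 0 e₁ = K.face 0 e₂ ∧ K.face 0 e₀ = K.face 1 e₂ ∧ K.face 1 e₀ = K.face 1 e₁) := by
    grind
  exact this.imp (fun h => ⟨h.1, h.2.1, h.2.2⟩) (fun h => ⟨h.1, h.2.1, h.2.2⟩)

theorem boundaryTwo_apply_eq_zero {c : K.cell 2 →₀ ℤ} {f : K.cell 1}
    (h : ∀ x, K.IsEdge f x → c x = 0) : K.boundaryTwo c f = 0 := by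
  have : K.boundaryTwo c = c.sum fun x k => k • K.triangleChain (K.edges x) := rfl
  rw [this, Finsupp.sum, Finsupp.finsetSum_apply]
  refine Finset.sum_eq_zero fun x _ => ?_
  rw [Finsupp.smul_apply]
  by_cases hx : K.IsEdge f x
  · rw [h x hx, zero_smul]
  · rw [triangleChain_apply_eq_zero (e := K.edges x) hx, smul_zero]

theorem boundaryTwo_apply_congr {c d : K.cell 2 →₀ ℤ} {f : K.cell 1}
    (h : ∀ x, K.IsEdge f x → c x = d x) : K.boundaryTwo c f = K.boundaryTwo d f := by
  rw [← sub_eq_zero, ← Finsupp.sub_apply, ← map_sub]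
  exact boundaryTwo_apply_eq_zero fun x hx => by simp [h x hx]

/-- Around a 1-cell off the triangle, the 2-cells are all in `C` or all outside it. So the boundary
of the restriction agrees there with that of `c` or of `0`, and it is a 1-cycle carried by the
triangle. -/
theorem exists_smul_eq_boundaryTwo_filter
    (h1 : ∀ e : K.cell 1, Function.Injective fun i => K.face i e)
    {e : Fin 3 → K.cell 1} (he : K.IsTriangle e) {C : Set (K.cell 2)}
    (hC : ∀ f a b, K.IsEdge f a → K.IsEdge f b → a ∈ C → b ∉ C → f ∈ Set.range e)
    {c : K.cell 2 →₀ ℤ} (hc : K.boundaryTwo c = 0) [DecidablePred (· ∈ C)] :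
    ∃ k : ℤ, K.boundaryTwo (c.filter (· ∈ C)) = k • K.triangleChain e := by
  refine he.eq_smul_triangleChain h1 (fun f hf => ?_) (boundaryOne_boundaryTwo _)
  by_cases h : ∃ a ∈ C, K.IsEdge f a
  · obtain ⟨a, ha, hfa⟩ := h
    rw [boundaryTwo_apply_congr (d := c), hc, Finsupp.zero_apply]
    intro b hb
    by_cases hbC : b ∈ C
    · exact Finsupp.filter_apply_pos _ _ hbC
    · exact absurd (hC f a b hfa hb ha hbC) hf
  · push Not at h
    exact boundaryTwo_apply_eq_zero fun x hx => Finsupp.filter_apply_neg _ _ fun hxC => h x hxC hx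

/-! ### Strong connectedness and rigidity of 2-cycles -/

/-- Two 2-cells share an edge. -/
def SharesEdge (K : DeltaComplex.{u}) (x x' : K.cell 2) : Prop :=
  ∃ e, K.IsEdge e x ∧ K.IsEdge e x'

/-- Any two 2-cells are joined by a sequence of 2-cells in which consecutive members share an
edge. -/
def StronglyConnected (K : DeltaComplex.{u}) : Prop :=
  ∀ x x', Relation.ReflTransGen K.SharesEdge x x'



theorem eq_or_eq_of_isEdge (h3 : ∀ e : K.cell 1, {x | K.IsEdge e x}.ncard = 2)
    {f : K.cell 1} {a a' b : K.cell 2} (ha : K.IsEdge f a)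
    (ha' : K.IsEdge f a') (hne : a ≠ a') (hb : K.IsEdge f b) : b = a ∨ b = a' := by
  obtain ⟨p, q, -, hpq⟩ := Set.ncard_eq_two.1 (h3 f)
  have h (x) : K.IsEdge f x ↔ x = p ∨ x = q := by
    rw [← Set.mem_ofPred_eq (p := fun x => K.IsEdge f x), hpq]; rfl
  rw [h] at ha ha' hb
  grind

theorem exists_ne_isEdge (h3 : ∀ e : K.cell 1, {x | K.IsEdge e x}.ncard = 2) {f : K.cell 1}
    (a : K.cell 2) : ∃ a', a' ≠ a ∧ K.IsEdge f a' := by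
  obtain ⟨a', ha', hne⟩ := Set.exists_ne_of_one_lt_ncard (by rw [h3 f]; norm_num) a
  exact ⟨a', hne, ha'⟩

theorem boundaryTwo_apply (h3 : ∀ e : K.cell 1, {x | K.IsEdge e x}.ncard = 2) {f : K.cell 1}
    {a a' : K.cell 2} (ha : K.IsEdge f a) (ha' : K.IsEdge f a') (hne : a ≠ a')
    (c : K.cell 2 →₀ ℤ) :
    K.boundaryTwo c f = c a * K.triangleChain (K.edges a) f +
      c a' * K.triangleChain (K.edges a') f := by
  classical
  rw [boundaryTwo_apply_congr (d := Finsupp.single a (c a) + Finsupp.single a' (c a'))]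
  · simp [boundaryTwo_single]
  · intro x hx
    rcases eq_or_eq_of_isEdge h3 ha ha' hne hx with rfl | rfl <;> simp [hne, hne.symm]


/-- At an edge shared by different `x` and `x'`, the boundary of `c` has the coefficient `± c x ± c
x'`. -/
theorem eq_zero_of_sharesEdge (h3 : ∀ e : K.cell 1, {x | K.IsEdge e x}.ncard = 2)
    (h1 : ∀ e : K.cell 1, Function.Injective fun i => K.face i e) {c : K.cell 2 →₀ ℤ}
    (hc : K.boundaryTwo c = 0) {x x' : K.cell 2} (h : K.SharesEdge x x') (hx : c x = 0) :
    c x' = 0 := by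
  obtain ⟨f, hf, hf'⟩ := h
  rcases eq_or_ne x x' with rfl | hne
  · exact hx
  have hb := DFunLike.congr_fun hc f
  obtain ⟨i, rfl⟩ := isEdge_iff.1 hf'
  rw [boundaryTwo_apply h3 hf hf' hne, hx, zero_mul, zero_add, Finsupp.zero_apply] at hb
  rcases triangleChain_apply_eq ((isTriangle_edges x').injective h1) i with h | h <;>
    simpa [h] using hb

theorem StronglyConnected.eq_zero (hs : K.StronglyConnected)
    (h3 : ∀ e : K.cell 1, {x | K.IsEdge e x}.ncard = 2)
    (h1 : ∀ e : K.cell 1, Function.Injective fun i => K.face i e) {c : K.cell 2 →₀ ℤ}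
    (hc : K.boundaryTwo c = 0) {x : K.cell 2} (hx : c x = 0) : c = 0 := by
  ext x'
  induction hs x x' with
  | refl => exact hx
  | tail _ h ih => exact eq_zero_of_sharesEdge h3 h1 hc h ih

/-- Evaluation at a single 2-cell embeds the group of 2-cycles in `ℤ`, so one nonzero cycle
suffices. -/
theorem StronglyConnected.orientable (hs : K.StronglyConnected)
    (h3 : ∀ e : K.cell 1, {x | K.IsEdge e x}.ncard = 2)
    (h1 : ∀ e : K.cell 1, Function.Injective fun i => K.face i e) {c : K.cell 2 →₀ ℤ}
    (hc : K.boundaryTwo c = 0) (hc0 : c ≠ 0) :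
    Nonempty (LinearMap.ker K.boundaryTwo ≃ₗ[ℤ] ℤ) := by
  obtain ⟨x, hx⟩ := Finsupp.ne_iff.1 hc0
  refine LinearMap.nonempty_equiv_int_of_injective
    ((Finsupp.lapply x).comp (LinearMap.ker K.boundaryTwo).subtype)
    ((injective_iff_map_eq_zero _).2 fun d hd => ?_) (m := ⟨c, hc⟩) ?_
  · exact Subtype.ext (hs.eq_zero h3 h1 d.2 hd)
  · exact fun h => hc0 (congrArg Subtype.val h)


theorem exists_cycle_of_orientable (h : Nonempty (LinearMap.ker K.boundaryTwo ≃ₗ[ℤ] ℤ)) :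
    ∃ c, K.boundaryTwo c = 0 ∧ c ≠ 0 := by
  obtain ⟨φ⟩ := h
  refine ⟨(φ.symm 1).1, (φ.symm 1).2, fun h => ?_⟩
  have : φ.symm 1 = 0 := Subtype.ext h
  simp at this

theorem Adjacent.symm {w w' : K.cell 0} (h : K.Adjacent w w') : K.Adjacent w' w := by
  obtain ⟨e, he⟩ := h
  exact ⟨e, he.symm⟩

theorem adjacent_reflTransGen_symm {w w' : K.cell 0}
    (h : Relation.ReflTransGen K.Adjacent w w') : Relation.ReflTransGen K.Adjacent w' w := by
  induction h with
  | refl => exact .refl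
  | tail _ h ih => exact .head h.symm ih

theorem isVertex_face (i : Fin 2) (j : Fin 3) (x : K.cell 2) :
    K.IsVertex (K.face i (K.face j x)) x := ⟨_, ⟨j, rfl⟩, i, rfl⟩

theorem reflTransGen_adjacent_of_isVertex {w w' : K.cell 0} {x : K.cell 2}
    (hw : K.IsVertex w x) (hw' : K.IsVertex w' x) : Relation.ReflTransGen K.Adjacent w w' := by
  have a := (isTriangle_edges x).face_zero_one
  have b := (isTriangle_edges x).face_zero_two
  have c := (isTriangle_edges x).face_one_two
  have adj (i) : K.Adjacent (K.face 0 (K.edges x i)) (K.face 1 (K.edges x i)) :=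
    ⟨_, .inl ⟨rfl, rfl⟩⟩
  have h0 := adj 0
  have h1 := adj 1
  have key (v) (hv : K.IsVertex v x) :
      Relation.ReflTransGen K.Adjacent (K.face 0 (K.edges x 0)) v := by
    obtain ⟨_, ⟨j, rfl⟩, i, rfl⟩ := hv
    change Relation.ReflTransGen K.Adjacent _ (K.face i (K.edges x j))
    rw [a] at h1
    have t1 : Relation.ReflTransGen K.Adjacent (K.face 0 (K.edges x 0))
        (K.face 0 (K.edges x 1)) := by rw [a]
    have t2 : Relation.ReflTransGen K.Adjacent (K.face 0 (K.edges x 0))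
        (K.face 0 (K.edges x 2)) := by rw [b]; exact .single h0
    have t3 : Relation.ReflTransGen K.Adjacent (K.face 0 (K.edges x 0))
        (K.face 1 (K.edges x 2)) := by rw [c]; exact .single h1
    fin_cases i <;> fin_cases j
    exacts [.refl, t1, t2, .single h0, .single h1, t3]
  exact (adjacent_reflTransGen_symm (key w hw)).trans (key w' hw')

/-- Follow a path of vertices: the linking axiom moves between the 2-cells around one vertex, and a
2-cell containing the next 1-cell of the path passes on to the next vertex. -/
theorem IsMComplex.stronglyConnected (hK : K.IsMComplex) : K.StronglyConnected := by
  intro x x'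
  have link {w y y'} (hy : K.IsVertex w y) (hy' : K.IsVertex w y') :
      Relation.ReflTransGen K.SharesEdge y y' :=
    (hK.linked w y y' hy hy').lift id fun _ _ ⟨e, _, h⟩ => ⟨e, h⟩
  suffices ∀ w, Relation.ReflTransGen K.Adjacent (K.face 0 (K.face 0 x)) w →
      ∀ y, K.IsVertex w y → Relation.ReflTransGen K.SharesEdge x y from
    this _ (hK.connected _ _) x' (isVertex_face 0 0 x')
  intro w hw
  induction hw with
  | refl => exact fun y hy => link (isVertex_face 0 0 x) hy
  | tail _ h ih =>
    intro y hy
    obtain ⟨e, he⟩ := h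
    obtain ⟨z, hz⟩ := hK.exists_triangle e
    rcases he with ⟨rfl, rfl⟩ | ⟨rfl, rfl⟩
    · exact (ih z ⟨e, hz, 0, rfl⟩).trans (link ⟨e, hz, 1, rfl⟩ hy)
    · exact (ih z ⟨e, hz, 1, rfl⟩).trans (link ⟨e, hz, 0, rfl⟩ hy)

theorem StronglyConnected.connected (hs : K.StronglyConnected)
    (h : ∀ w, ∃ x, K.IsVertex w x) (w w' : K.cell 0) :
    Relation.ReflTransGen K.Adjacent w w' := by
  obtain ⟨x, hx⟩ := h w
  obtain ⟨x', hx'⟩ := h w'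
  induction hs x x' generalizing w' with
  | refl => exact reflTransGen_adjacent_of_isVertex hx hx'
  | tail _ h ih =>
    obtain ⟨e, hy, hy'⟩ := h
    exact (ih (K.face 0 e) ⟨e, hy, 0, rfl⟩).trans
      (reflTransGen_adjacent_of_isVertex ⟨e, hy', 0, rfl⟩ hx')

/-! ### The complement of a 2-cell, and a criterion for cut-triangles -/

/-- In an `M`-complex, a nonempty set of 2-cells whose frontier lies in the boundary of a 2-cell
outside it contains all other 2-cells. -/
theorem IsMComplex.mem_of_frontier_subset (hK : K.IsMComplex) {x : K.cell 2}
    {C : Set (K.cell 2)} (hx : x ∉ C) (hne : C.Nonempty)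
    (hC : ∀ f a b, K.IsEdge f a → K.IsEdge f b → a ∈ C → b ∉ C → K.IsEdge f x)
    {y : K.cell 2} (hy : y ≠ x) : y ∈ C := by
  classical
  obtain ⟨c, hc, hc0⟩ := exists_cycle_of_orientable hK.orientable
  obtain ⟨k, hk⟩ := exists_smul_eq_boundaryTwo_filter hK.regular_one (isTriangle_edges x) hC hc
  -- This cycle agrees with `c` on `C` and vanishes at every 2-cell outside `C` other than `x`. If
  -- there is such a 2-cell, then the cycle is zero, and so is `c`.
  have hd : K.boundaryTwo (c.filter (· ∈ C) - Finsupp.single x k) = 0 := by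
    rw [map_sub, hk, boundaryTwo_single, sub_self]
  by_contra hyC
  have h0 := hK.stronglyConnected.eq_zero hK.two_triangles hK.regular_one hd (x := y)
    (by simp [hyC, hy])
  obtain ⟨a, ha⟩ := hne
  have hax : a ≠ x := fun h => hx (h ▸ ha)
  have := DFunLike.congr_fun h0 a
  simp [ha, hax] at this
  exact hc0 (hK.stronglyConnected.eq_zero hK.two_triangles hK.regular_one hc this)

/-- If all edges of `a` were edges of `x`, then `a` and `x` would have equal faces. These edges
would have no room for a third 2-cell, so strong connectedness would make the complex an identity.
-/
theorem IsProperMComplex.exists_isEdge (hK : K.IsProperMComplex) {x a : K.cell 2} (ha : a ≠ x) :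
    ∃ f, K.IsEdge f a ∧ ¬ K.IsEdge f x := by
  by_contra! h
  have heq : K.edges a = K.edges x := (isTriangle_edges x).eq_of_forall_mem_range
    hK.1.regular_one (isTriangle_edges a) fun i => h _ ⟨i, rfl⟩
  refine hK.2 ⟨x, a, ha.symm, fun z => ?_, fun i => (congrFun heq i).symm⟩
  induction hK.1.stronglyConnected x z with
  | refl => exact .inl rfl
  | tail _ h ih =>
    obtain ⟨f, hf, hf'⟩ := h
    have hfx : K.IsEdge f x := by
      rcases ih with rfl | rfl
      · exact hf
      · exact isEdge_iff.2 (heq ▸ isEdge_iff.1 hf)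
    exact eq_or_eq_of_isEdge hK.1.two_triangles hfx (isEdge_iff.2 (heq.symm ▸ isEdge_iff.1 hfx))
      ha.symm hf'

/-- The two classes are `A` and its complement: `hcross` keeps them apart, `hconn` and `hconn'` link
each of them. A transitive closure need not be reflexive; `hoff` makes it so. -/
theorem IsTriangle.isReducible {e : Fin 3 → K.cell 1} (he : K.IsTriangle e)
    (hoff : ∀ a, ∃ f, K.IsEdge f a ∧ f ∉ Set.range e) {A : Set (K.cell 2)}
    (hA : A.Nonempty) (hA' : Aᶜ.Nonempty)
    (hcross : ∀ f a b, K.IsEdge f a → K.IsEdge f b → a ∈ A → b ∉ A → f ∈ Set.range e)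
    (hconn : ∀ a ∈ A, ∀ b ∈ A, Relation.ReflTransGen (K.SharesEdgeOff (Set.range e)) a b)
    (hconn' : ∀ a ∉ A, ∀ b ∉ A, Relation.ReflTransGen (K.SharesEdgeOff (Set.range e)) a b) :
    K.IsReducible := by
  have hr (a) : K.SharesEdgeOff (Set.range e) a a := by
    obtain ⟨f, hf, hfe⟩ := hoff a
    exact ⟨f, hfe, hf, hf⟩
  have hsymm {a b} (h : K.SharesEdgeOff (Set.range e) a b) : K.SharesEdgeOff (Set.range e) b a := by
    obtain ⟨f, hf, ha, hb⟩ := h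
    exact ⟨f, hf, hb, ha⟩
  have hgen {a b} (h : Relation.ReflTransGen (K.SharesEdgeOff (Set.range e)) a b) :
      Relation.TransGen (K.SharesEdgeOff (Set.range e)) a b := .head' (hr a) h
  have hiff {a b} (h : Relation.TransGen (K.SharesEdgeOff (Set.range e)) a b) :
      a ∈ A ↔ b ∈ A := by
    have step {s t} (hst : K.SharesEdgeOff (Set.range e) s t) (hs : s ∈ A) : t ∈ A := by
      by_contra ht
      obtain ⟨f, hf, hfs, hft⟩ := hst
      exact hf (hcross f s t hfs hft hs ht)
    induction h with
    | single h => exact ⟨step h, step (hsymm h)⟩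
    | tail _ h ih => exact ih.trans ⟨step h, step (hsymm h)⟩
  refine ⟨Set.range e, ⟨e 0, e 1, e 2, ?_, he.boundaryOne_triangleChain⟩,
    ⟨fun a => .single (hr a), fun h => ?_, fun h h' => h.trans h'⟩, ?_⟩
  · ext f
    simp [Fin.exists_fin_succ, eq_comm]
  · have : Std.Symm (K.SharesEdgeOff (Set.range e)) := ⟨fun _ _ => hsymm⟩
    exact Relation.TransGen.stdSymm.symm _ _ h
  · obtain ⟨a, ha⟩ := hA
    obtain ⟨b, hb⟩ := hA'
    rw [Nat.card_eq_two_iff]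
    refine ⟨Quotient.mk _ a, Quotient.mk _ b, fun h => ?_, Set.eq_univ_of_forall fun q => ?_⟩
    · exact hb ((hiff (Quotient.exact h)).1 ha)
    · induction q using Quotient.inductionOn with | _ c
      by_cases hc : c ∈ A
      · exact .inl (Quotient.sound (hgen (hconn c hc a ha)))
      · exact .inr (Quotient.sound (hgen (hconn' c hc b hb)))

/-! ### Transport of linking from the complement of a 2-cell -/

section Embedding

variable {X : DeltaComplex.{u}} {x : X.cell 2} {p : X.cell 1 → K.cell 1}
  {q : {z : X.cell 2 // z ≠ x} → K.cell 2}

/-- The set reached from `a` without crossing an edge of `x` has its frontier in the boundary of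
`x`, so it contains every 2-cell but `x`. -/
theorem IsMComplex.reflTransGen_sharesEdgeOff (hX : X.IsMComplex) {a b : X.cell 2} (ha : a ≠ x)
    (hb : b ≠ x) : Relation.ReflTransGen (X.SharesEdgeOff (Set.range (X.edges x))) a b := by
  let C : Set (X.cell 2) :=
    {b | Relation.ReflTransGen (X.SharesEdgeOff (Set.range (X.edges x))) a b}
  have hxC : x ∉ C := by
    intro h
    rcases Relation.ReflTransGen.cases_tail h with h | ⟨_, _, f, hf, _, hfx⟩
    · exact ha h.symm
    · exact hf hfx
  refine hX.mem_of_frontier_subset hxC ⟨a, .refl⟩ (fun f s t hs ht hsC htC => ?_) hb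
  by_contra hf
  exact htC (.tail hsC ⟨f, hf, hs, ht⟩)

theorem IsMComplex.reflTransGen_sharesEdgeOff_map (hX : X.IsMComplex)
    (hp : Function.Injective p) (hq : ∀ i z, K.face i (q z) = p (X.face i z.1))
    (a b : {z : X.cell 2 // z ≠ x}) :
    Relation.ReflTransGen (K.SharesEdgeOff (Set.range fun i => p (X.edges x i))) (q a) (q b) := by
  obtain ⟨b, hb⟩ := b
  induction hX.reflTransGen_sharesEdgeOff a.2 hb with
  | refl => exact .refl
  | @tail c d _ h ih =>
    obtain ⟨f, hf, ⟨i, hi⟩, ⟨j, hj⟩⟩ := h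
    have hc : c ≠ x := by
      rintro rfl
      exact hf ⟨i, hi⟩
    refine (ih hc).tail ⟨p f, ?_, ⟨i, by rw [hq, hi]⟩, ⟨j, by rw [hq, hj]⟩⟩
    rintro ⟨k, hk⟩
    exact hf ⟨k, hp hk⟩

theorem IsProperMComplex.exists_isEdge_map (hX : X.IsProperMComplex)
    (hp : Function.Injective p) (hq : ∀ i z, K.face i (q z) = p (X.face i z.1))
    (a : {z : X.cell 2 // z ≠ x}) :
    ∃ f, K.IsEdge f (q a) ∧ f ∉ Set.range fun i => p (X.edges x i) := by
  obtain ⟨f, ⟨i, hi⟩, hfx⟩ := hX.exists_isEdge a.2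
  refine ⟨p f, ⟨i, by rw [hq, hi]⟩, ?_⟩
  rintro ⟨k, hk⟩
  exact hfx ⟨k, hp hk⟩

end Embedding

/-! ### The 1-cells of a connected sum -/

section ConnectedSum

variable {X Y : DeltaComplex.{u}} {x : X.cell 2} {y : Y.cell 2}

open Classical in
/-- The map from the 1-cells of `X` and `Y` that sends the faces of `y` to those of `x` and fixes
the other 1-cells. -/
noncomputable def edgeRetraction (X Y : DeltaComplex.{u}) (x : X.cell 2) (y : Y.cell 2) :
    X.cell 1 ⊕ Y.cell 1 → X.cell 1 ⊕ Y.cell 1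
  | .inl f => .inl f
  | .inr g => if h : ∃ i, Y.edges y i = g then .inl (X.edges x h.choose) else .inr g

theorem edgeRetraction_face (hy : Function.Injective (Y.edges y)) (i : Fin 3) :
    edgeRetraction X Y x y (.inr (Y.edges y i)) = .inl (X.edges x i) := by
  have h : ∃ j, Y.edges y j = Y.edges y i := ⟨i, rfl⟩
  simp only [edgeRetraction, dif_pos h]
  rw [hy h.choose_spec]

theorem edgeRetraction_of_notMem {g : Y.cell 1} (hg : g ∉ Set.range (Y.edges y)) :
    edgeRetraction X Y x y (.inr g) = .inr g :=
  dif_neg hg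

/-- The retraction respects the generating identifications, so it descends to the quotient. This
replaces an analysis of the generated equivalence relation. -/
theorem edgeRetraction_eq_of_mk_eq (hy : Function.Injective (Y.edges y))
    {s t : X.cell 1 ⊕ Y.cell 1}
    (h : Quot.mk (EdgeGlue X Y x y) s = Quot.mk (EdgeGlue X Y x y) t) :
    edgeRetraction X Y x y s = edgeRetraction X Y x y t :=
  congrArg (Quot.lift (edgeRetraction X Y x y) fun _ _ hst => by
    cases hst with | mk i => exact (edgeRetraction_face hy i).symm) h

theorem mk_inl_injective (hy : Function.Injective (Y.edges y)) :
    Function.Injective fun f => Quot.mk (EdgeGlue X Y x y) (.inl f) := fun _ _ h =>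
  Sum.inl_injective (edgeRetraction_eq_of_mk_eq hy h)

theorem mem_range_edges_of_mk_inl_eq (hy : Function.Injective (Y.edges y)) {f : X.cell 1}
    {g : Y.cell 1}
    (h : Quot.mk (EdgeGlue X Y x y) (.inl f) = Quot.mk (EdgeGlue X Y x y) (.inr g)) :
    f ∈ Set.range (X.edges x) := by
  have h' := edgeRetraction_eq_of_mk_eq hy h
  by_cases hg : g ∈ Set.range (Y.edges y)
  · obtain ⟨i, rfl⟩ := hg
    rw [edgeRetraction_face hy] at h'
    exact ⟨i, (Sum.inl_injective h').symm⟩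
  · rw [edgeRetraction_of_notMem hg] at h'
    cases h'

theorem mk_inr_injective (hx : Function.Injective (X.edges x))
    (hy : Function.Injective (Y.edges y)) :
    Function.Injective fun g => Quot.mk (EdgeGlue X Y x y) (.inr g) := by
  intro g g' h
  have h' := edgeRetraction_eq_of_mk_eq hy h
  by_cases hg : g ∈ Set.range (Y.edges y) <;> by_cases hg' : g' ∈ Set.range (Y.edges y)
  · obtain ⟨i, rfl⟩ := hg
    obtain ⟨j, rfl⟩ := hg'
    rw [edgeRetraction_face hy, edgeRetraction_face hy] at h'
    rw [hx (Sum.inl_injective h')]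
  · obtain ⟨i, rfl⟩ := hg
    rw [edgeRetraction_face hy, edgeRetraction_of_notMem hg'] at h'
    cases h'
  · obtain ⟨j, rfl⟩ := hg'
    rw [edgeRetraction_of_notMem hg, edgeRetraction_face hy] at h'
    cases h'
  · rw [edgeRetraction_of_notMem hg, edgeRetraction_of_notMem hg'] at h'
    exact Sum.inr_injective h'

end ConnectedSum

/-! ### Decomposable complexes are reducible -/

theorem IsDecomposable.isReducible (h : K.IsDecomposable) : K.IsReducible := by
  obtain ⟨X, Y, x, y, hX, hY, hiso⟩ := h
  obtain ⟨φ, hφ⟩ := hiso.symm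
  have hx : Function.Injective (X.edges x) := hX.1.regular_two x
  have hy : Function.Injective (Y.edges y) := hY.1.regular_two y
  let pX (f : X.cell 1) : K.cell 1 := φ.map 1 (Quot.mk (EdgeGlue X Y x y) (.inl f))
  let pY (f : Y.cell 1) : K.cell 1 := φ.map 1 (Quot.mk (EdgeGlue X Y x y) (.inr f))
  let qX (z : {z : X.cell 2 // z ≠ x}) : K.cell 2 := φ.map 2 (Sum.inl z)
  let qY (z : {z : Y.cell 2 // z ≠ y}) : K.cell 2 := φ.map 2 (Sum.inr z)
  have hpX : Function.Injective pX := (hφ 1).1.comp (mk_inl_injective hy)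
  have hpY : Function.Injective pY := (hφ 1).1.comp (mk_inr_injective hx hy)
  have hqX (i z) : K.face i (qX z) = pX (X.face i z.1) := (φ.map_face 1 i (Sum.inl z)).symm
  have hqY (i z) : K.face i (qY z) = pY (Y.face i z.1) := (φ.map_face 1 i (Sum.inr z)).symm
  -- Both summands see the same triangle, so the statements about `X` apply to `Y` after rewriting.
  have hT : (fun i => pX (X.edges x i)) = fun i => pY (Y.edges y i) :=
    funext fun i => congrArg (φ.map 1) (Quot.sound (EdgeGlue.mk i))
  have hsurj (a : K.cell 2) : (∃ z, qX z = a) ∨ ∃ z, qY z = a := by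
    obtain ⟨z | z, rfl⟩ := (hφ 2).2 a
    exacts [.inl ⟨z, rfl⟩, .inr ⟨z, rfl⟩]
  have hdisj (z z') : qX z ≠ qY z' := fun h => by cases (hφ 2).1 h
  have hY_of {a} (ha : a ∉ Set.range qX) : ∃ z, qY z = a := (hsurj a).resolve_left ha
  have hface (i : Fin 2) (j : Fin 3) : K.face i (pX (X.edges x j)) =
      φ.map 0 (Quot.mk (VertexGlue X Y x y) (.inl (X.face i (X.edges x j)))) :=
    (φ.map_face 0 i _).symm
  have hx' := isTriangle_edges x
  have htri : K.IsTriangle fun i => pX (X.edges x i) :=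
    ⟨by rw [hface, hface, hx'.face_zero_one], by rw [hface, hface, hx'.face_zero_two],
      by rw [hface, hface, hx'.face_one_two]⟩
  -- The second 2-cell on an edge of `x` survives in the sum, so neither side is empty.
  obtain ⟨a, ha, -⟩ := exists_ne_isEdge hX.1.two_triangles (f := X.edges x 0) x
  obtain ⟨b, hb, -⟩ := exists_ne_isEdge hY.1.two_triangles (f := Y.edges y 0) y
  refine htri.isReducible (fun a => ?_) (A := Set.range qX) ⟨_, ⟨a, ha⟩, rfl⟩
    ⟨qY ⟨b, hb⟩, fun ⟨z, hz⟩ => hdisj _ _ hz⟩ ?_ ?_ ?_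
  · rcases hsurj a with ⟨z, rfl⟩ | ⟨z, rfl⟩
    · exact hX.exists_isEdge_map hpX hqX z
    · rw [hT]
      exact hY.exists_isEdge_map hpY hqY z
  · rintro f a b ⟨i, rfl⟩ ⟨j, hj⟩ ⟨z, rfl⟩ hb
    obtain ⟨z', rfl⟩ := hY_of hb
    rw [hqX, hqY] at hj
    obtain ⟨k, hk⟩ := mem_range_edges_of_mk_inl_eq hy ((hφ 1).1 hj.symm)
    exact ⟨k, by rw [hqX, ← hk]⟩
  · rintro _ ⟨z, rfl⟩ _ ⟨z', rfl⟩
    exact hX.1.reflTransGen_sharesEdgeOff_map hpX hqX z z'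
  · intro a ha b hb
    obtain ⟨z, rfl⟩ := hY_of ha
    obtain ⟨z', rfl⟩ := hY_of hb
    rw [hT]
    exact hY.1.reflTransGen_sharesEdgeOff_map hpY hqY z z'

/-! ### Capping one side of a triangle -/

section Cap

/-- The cells of the complex obtained from the set `A` of 2-cells by adding a 2-cell. -/
def CapCell (K : DeltaComplex.{u}) (A : Set (K.cell 2)) : ℕ → Type u
  | 0 => {w : K.cell 0 // ∃ a ∈ A, K.IsVertex w a}
  | 1 => {f : K.cell 1 // ∃ a ∈ A, K.IsEdge f a}
  | 2 => Option A
  | _ + 3 => PEmpty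

/-- The faces of the complex obtained from `A` by adding a 2-cell with faces `e i`. -/
def capFace {A : Set (K.cell 2)} {e : Fin 3 → K.cell 1}
    (heA : ∀ i, ∃ a ∈ A, K.IsEdge (e i) a) :
    {n : ℕ} → Fin (n + 2) → CapCell K A (n + 1) → CapCell K A n
  | 0, i, f => ⟨K.face i f.1, f.2.imp fun _ h => ⟨h.1, f.1, h.2, i, rfl⟩⟩
  | 1, i, some a => ⟨K.face i a.1, a.1, a.2, i, rfl⟩
  | 1, i, none => ⟨e i, heA i⟩
  | _ + 2, _, c => PEmpty.elim c

/-- The complex generated by the set `A` of 2-cells, capped by an additional 2-cell whose faces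
are `e 0, e 1, e 2`. -/
def cap {A : Set (K.cell 2)} {e : Fin 3 → K.cell 1} (he : K.IsTriangle e)
    (heA : ∀ i, ∃ a ∈ A, K.IsEdge (e i) a) : DeltaComplex.{u} where
  cell := CapCell K A
  face := capFace heA
  face_face := by
    intro n i j hij c
    match n, c with
    | 0, some a => exact Subtype.ext (K.face_face i j hij a.1)
    | 0, none => exact Subtype.ext (he.face_face i j hij)
    | _ + 1, c => exact PEmpty.elim c

variable {A : Set (K.cell 2)} {e : Fin 3 → K.cell 1} {he : K.IsTriangle e}
  {heA : ∀ i, ∃ a ∈ A, K.IsEdge (e i) a}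

theorem isEdge_cap_some {f : (cap he heA).cell 1} {a : A} :
    (cap he heA).IsEdge f (some a) ↔ K.IsEdge f.1 a :=
  exists_congr fun _ => Subtype.ext_iff

theorem isEdge_cap_none {f : (cap he heA).cell 1} :
    (cap he heA).IsEdge f none ↔ f.1 ∈ Set.range e :=
  exists_congr fun _ => Subtype.ext_iff

theorem isVertexOfEdge_cap {w : (cap he heA).cell 0} {f : (cap he heA).cell 1} :
    (cap he heA).IsVertexOfEdge w f ↔ K.IsVertexOfEdge w.1 f.1 :=
  exists_congr fun _ => Subtype.ext_iff

open Classical in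
/-- The 2-cells outside `A` are mapped to the additional 2-cell. -/
noncomputable def collapse (he : K.IsTriangle e) (heA : ∀ i, ∃ a ∈ A, K.IsEdge (e i) a)
    (z : K.cell 2) : (cap he heA).cell 2 :=
  if h : z ∈ A then some ⟨z, h⟩ else none

theorem collapse_of_mem {z : K.cell 2} (hz : z ∈ A) : collapse he heA z = some ⟨z, hz⟩ :=
  dif_pos hz

theorem collapse_of_notMem {z : K.cell 2} (hz : z ∉ A) : collapse he heA z = none :=
  dif_neg hz

section Crossing

/-- The common edges of 2-cells in `A` and 2-cells outside `A` lie in the triangle. -/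
def FrontierSubset (K : DeltaComplex.{u}) (A : Set (K.cell 2)) (e : Fin 3 → K.cell 1) : Prop :=
  ∀ f a b, K.IsEdge f a → K.IsEdge f b → a ∈ A → b ∉ A → f ∈ Set.range e

theorem FrontierSubset.compl (h : K.FrontierSubset A e) : K.FrontierSubset Aᶜ e :=
  fun f a b ha hb haA hbA => h f b a hb ha (not_not.1 hbA) haA

theorem FrontierSubset.isEdge_collapse (h : K.FrontierSubset A e) {f : (cap he heA).cell 1}
    {z : K.cell 2} (hz : K.IsEdge f.1 z) : (cap he heA).IsEdge f (collapse he heA z) := by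
  by_cases hzA : z ∈ A
  · rw [collapse_of_mem hzA]
    exact isEdge_cap_some.2 hz
  · rw [collapse_of_notMem hzA]
    obtain ⟨a, ha, hfa⟩ := f.2
    exact isEdge_cap_none.2 (h f.1 a z hfa hz ha hzA)

/-- A step over an edge of no 2-cell in `A` stays outside `A` and becomes stationary; any other step
survives. The predicate `P` serves strong connectedness (no condition) and linking (having a given
vertex) alike. -/
theorem FrontierSubset.reflTransGen_collapse (h : K.FrontierSubset A e)
    {P : K.cell 1 → Prop} {z z' : K.cell 2}
    (hz : Relation.ReflTransGen (fun s t => ∃ f, P f ∧ K.IsEdge f s ∧ K.IsEdge f t) z z') :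
    Relation.ReflTransGen
      (fun s t => ∃ f : (cap he heA).cell 1, P f.1 ∧ (cap he heA).IsEdge f s ∧
        (cap he heA).IsEdge f t) (collapse he heA z) (collapse he heA z') := by
  induction hz with
  | refl => exact .refl
  | @tail s t _ hst ih =>
    obtain ⟨f, hP, hfs, hft⟩ := hst
    by_cases hf : ∃ a ∈ A, K.IsEdge f a
    · exact ih.tail ⟨⟨f, hf⟩, hP, h.isEdge_collapse (f := ⟨f, hf⟩) hfs,
        h.isEdge_collapse (f := ⟨f, hf⟩) hft⟩
    · have hs : s ∉ A := fun hs => hf ⟨s, hs, hfs⟩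
      have ht : t ∉ A := fun ht => hf ⟨t, ht, hft⟩
      rwa [collapse_of_notMem ht, ← collapse_of_notMem hs]

/-- Incidences lift along the collapse: for the new 2-cell, `heA'` supplies a 2-cell outside `A` on
the given edge. -/
theorem exists_collapse_eq (heA' : ∀ i, ∃ b ∉ A, K.IsEdge (e i) b)
    {f : (cap he heA).cell 1} {u : (cap he heA).cell 2} (hu : (cap he heA).IsEdge f u) :
    ∃ z, K.IsEdge f.1 z ∧ collapse he heA z = u := by
  match u with
  | some a => exact ⟨a, isEdge_cap_some.1 hu, collapse_of_mem a.2⟩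
  | none =>
    obtain ⟨i, hi⟩ := isEdge_cap_none.1 hu
    obtain ⟨b, hb, hfb⟩ := heA' i
    exact ⟨b, hi ▸ hfb, collapse_of_notMem hb⟩

end Crossing

theorem collapse_surjective (heA' : ∀ i, ∃ b ∉ A, K.IsEdge (e i) b) :
    Function.Surjective (collapse he heA) := by
  intro u
  obtain ⟨z, -, hz⟩ := exists_collapse_eq heA' (f := (cap he heA).face (0 : Fin 3) u) ⟨0, rfl⟩
  exact ⟨z, hz⟩

/-- The inclusion of `A` in the capped complex. -/
def capInclusion (he : K.IsTriangle e) (heA : ∀ i, ∃ a ∈ A, K.IsEdge (e i) a) (a : A) :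
    (cap he heA).cell 2 := some a

/-- The additional 2-cell. -/
def capCell (he : K.IsTriangle e) (heA : ∀ i, ∃ a ∈ A, K.IsEdge (e i) a) :
    (cap he heA).cell 2 := none

/-- The 1-cells of the capped complex are 1-cells of `K`. -/
def capEdge (he : K.IsTriangle e) (heA : ∀ i, ∃ a ∈ A, K.IsEdge (e i) a)
    (f : (cap he heA).cell 1) : K.cell 1 := Subtype.val f

theorem capEdge_injective : Function.Injective (capEdge he heA) := Subtype.val_injective

/-- The restriction of a 2-chain to `A`, minus `k` times the additional 2-cell. -/
noncomputable def capChain (he : K.IsTriangle e) (heA : ∀ i, ∃ a ∈ A, K.IsEdge (e i) a)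
    (c : K.cell 2 →₀ ℤ) (k : ℤ) : (cap he heA).cell 2 →₀ ℤ :=
  Finsupp.mapDomain (capInclusion he heA) (c.subtypeDomain (· ∈ A)) -
    Finsupp.single (capCell he heA) k

theorem capChain_ne_zero (he : K.IsTriangle e) (heA : ∀ i, ∃ a ∈ A, K.IsEdge (e i) a)
    (c : K.cell 2 →₀ ℤ) {k : ℤ} (hk : k ≠ 0) : capChain he heA c k ≠ 0 := by
  intro h
  have h' := DFunLike.congr_fun h (capCell he heA)
  rw [capChain, Finsupp.sub_apply, Finsupp.mapDomain_of_notMem_range, Finsupp.single_eq_same] at h'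
  · simp at h'
    exact hk h'
  · rintro ⟨a, ha⟩
    exact Option.some_ne_none a ha

theorem mapDomain_triangleChain (g : Fin 3 → (cap he heA).cell 1) :
    Finsupp.mapDomain (capEdge he heA) ((cap he heA).triangleChain g) =
      K.triangleChain fun i => capEdge he heA (g i) := by
  have h := map_add (Finsupp.lmapDomain ℤ ℤ (capEdge he heA))
  have h' := map_sub (Finsupp.lmapDomain ℤ ℤ (capEdge he heA))
  simp only [Finsupp.lmapDomain_apply] at h h'
  simp only [triangleChain, h, h', Finsupp.mapDomain_single]

theorem mapDomain_boundaryTwo_capInclusion (g : A →₀ ℤ) :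
    Finsupp.mapDomain (capEdge he heA)
        ((cap he heA).boundaryTwo (Finsupp.mapDomain (capInclusion he heA) g)) =
      K.boundaryTwo (Finsupp.mapDomain Subtype.val g) := by
  induction g using Finsupp.induction_linear with
  | zero => simp
  | add g g' hg hg' => simp only [Finsupp.mapDomain_add, map_add, hg, hg']
  | single a r =>
    rw [Finsupp.mapDomain_single, Finsupp.mapDomain_single, boundaryTwo_single,
      boundaryTwo_single, Finsupp.mapDomain_smul, mapDomain_triangleChain]
    rfl

theorem mapDomain_subtypeDomain (c : K.cell 2 →₀ ℤ) [DecidablePred (· ∈ A)] :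
    Finsupp.mapDomain Subtype.val (c.subtypeDomain (· ∈ A)) = c.filter (· ∈ A) := by
  ext z
  by_cases hz : z ∈ A
  · rw [Finsupp.filter_apply_pos _ _ hz]
    exact Finsupp.mapDomain_apply Subtype.val_injective _ (⟨z, hz⟩ : A)
  · rw [Finsupp.filter_apply_neg _ _ hz, Finsupp.mapDomain_of_notMem_range]
    simpa using hz

/-- The restriction and `k` times the new 2-cell have the same boundary. This can be checked in `K`,
because the 1-chains of the cap embed in those of `K`. -/
theorem boundaryTwo_capChain {c : K.cell 2 →₀ ℤ} [DecidablePred (· ∈ A)] {k : ℤ}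
    (hc : K.boundaryTwo (c.filter (· ∈ A)) = k • K.triangleChain e) :
    (cap he heA).boundaryTwo (capChain he heA c k) = 0 := by
  have h : Finsupp.mapDomain (capEdge he heA)
      ((cap he heA).boundaryTwo (Finsupp.mapDomain (capInclusion he heA)
        (c.subtypeDomain (· ∈ A)))) =
      Finsupp.mapDomain (capEdge he heA)
        ((cap he heA).boundaryTwo (Finsupp.single (capCell he heA) k)) := by
    rw [mapDomain_boundaryTwo_capInclusion, mapDomain_subtypeDomain, hc, boundaryTwo_single,
      Finsupp.mapDomain_smul, mapDomain_triangleChain]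
    rfl
  rw [capChain, map_sub, Finsupp.mapDomain_injective capEdge_injective h, sub_self]

/-- The collapse is onto and both preserves and lifts incidences, so it carries over linking, strong
connectedness and the count of two 2-cells per edge. Orientability comes from `capChain`, which is
nonzero at the new 2-cell. -/
theorem cap_isMComplex (hK : K.IsMComplex) (he : K.IsTriangle e)
    (heA : ∀ i, ∃ a ∈ A, K.IsEdge (e i) a) (heA' : ∀ i, ∃ b ∉ A, K.IsEdge (e i) b)
    (hA : K.FrontierSubset A e) {c : K.cell 2 →₀ ℤ} [DecidablePred (· ∈ A)] {k : ℤ} (hk : k ≠ 0)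
    (hc : K.boundaryTwo (c.filter (· ∈ A)) = k • K.triangleChain e) :
    (cap he heA).IsMComplex := by
  have hsurj : Function.Surjective (collapse he heA) := collapse_surjective heA'
  have hsc : (cap he heA).StronglyConnected := by
    intro u u'
    obtain ⟨z, rfl⟩ := hsurj u
    obtain ⟨z', rfl⟩ := hsurj u'
    have h := (hK.stronglyConnected z z').lift (p := fun s t => ∃ f, True ∧ K.IsEdge f s ∧
      K.IsEdge f t) id fun _ _ ⟨f, hf⟩ => ⟨f, trivial, hf⟩
    exact (hA.reflTransGen_collapse h (he := he) (heA := heA)).lift id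
      fun _ _ ⟨f, _, hf⟩ => ⟨f, hf⟩
  have h1 (f : (cap he heA).cell 1) : Function.Injective fun i => (cap he heA).face i f :=
    fun i j h => hK.regular_one f.1 (congrArg Subtype.val h)
  have h3 (f : (cap he heA).cell 1) : {u | (cap he heA).IsEdge f u}.ncard = 2 := by
    obtain ⟨a, ha, hfa⟩ := f.2
    obtain ⟨b, hne, hfb⟩ := exists_ne_isEdge hK.two_triangles (f := f.1) a
    have himage : {u | (cap he heA).IsEdge f u} = {collapse he heA a, collapse he heA b} := by
      ext u
      constructor
      · intro hu
        obtain ⟨z, hz, rfl⟩ := exists_collapse_eq heA' hu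
        rcases eq_or_eq_of_isEdge hK.two_triangles hfa hfb hne.symm hz with rfl | rfl
        exacts [.inl rfl, .inr rfl]
      · rintro (rfl | rfl)
        exacts [hA.isEdge_collapse hfa, hA.isEdge_collapse hfb]
    -- The two images differ because `a` was chosen in `A`: the collapse is injective there and
    -- sends only 2-cells outside `A` to the new one.
    rw [himage, Set.ncard_pair]
    rw [collapse_of_mem ha]
    by_cases hb : b ∈ A
    · rw [collapse_of_mem hb]
      exact fun h => hne (congrArg Subtype.val (Option.some_injective _ h)).symm
    · rw [collapse_of_notMem hb]
      exact Option.some_ne_none _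
  have hvert (w : (cap he heA).cell 0) : ∃ f, (cap he heA).IsVertexOfEdge w f := by
    obtain ⟨a, ha, f, hf, hw⟩ := w.2
    exact ⟨⟨f, a, ha, hf⟩, isVertexOfEdge_cap.2 hw⟩
  have hedge (f : (cap he heA).cell 1) : ∃ u, (cap he heA).IsEdge f u := by
    obtain ⟨a, ha, hf⟩ := f.2
    exact ⟨some ⟨a, ha⟩, isEdge_cap_some.2 hf⟩
  have hfin := hK.finite
  have hfin' (n) : Finite (K.cell n) :=
    Finite.of_injective (Sigma.mk n : _ → Σ n, K.cell n) sigma_mk_injective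
  refine
    { connected := hsc.connected fun w => ?_
      finite := ?_
      empty_of_three_le := ?_
      exists_edge := hvert
      exists_triangle := hedge
      regular_two := ?_
      regular_one := h1
      two_triangles := h3
      linked := ?_
      orientable := ?_ }
  · obtain ⟨f, hf⟩ := hvert w
    obtain ⟨u, hu⟩ := hedge f
    exact ⟨u, f, hu, hf⟩
  · have hf0 : Finite (CapCell K A 0) := inferInstanceAs (Finite {w : K.cell 0 // _})
    have hf1 : Finite (CapCell K A 1) := inferInstanceAs (Finite {w : K.cell 1 // _})
    have hf2 : Finite (CapCell K A 2) := inferInstanceAs (Finite (Option A))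
    refine Finite.of_surjective (α := CapCell K A 0 ⊕ CapCell K A 1 ⊕ CapCell K A 2)
      (Sum.elim (Sigma.mk 0) (Sum.elim (Sigma.mk 1) (Sigma.mk 2))) ?_
    rintro ⟨n, s⟩
    match n, s with
    | 0, s => exact ⟨.inl s, rfl⟩
    | 1, s => exact ⟨.inr (.inl s), rfl⟩
    | 2, s => exact ⟨.inr (.inr s), rfl⟩
    | _ + 3, s => exact PEmpty.elim s
  · intro m hm
    obtain ⟨m, rfl⟩ := Nat.exists_eq_add_of_le' hm
    exact inferInstanceAs (IsEmpty PEmpty)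
  · intro u i j h
    match u with
    | some a => exact hK.regular_two a (congrArg Subtype.val h)
    | none => exact he.injective hK.regular_one (congrArg Subtype.val h)
  · rintro w u u' ⟨f, hfu, hwf⟩ ⟨f', hfu', hwf'⟩
    obtain ⟨z, hz, rfl⟩ := exists_collapse_eq heA' hfu
    obtain ⟨z', hz', rfl⟩ := exists_collapse_eq heA' hfu'
    have h := hK.linked w.1 z z' ⟨f.1, hz, isVertexOfEdge_cap.1 hwf⟩
      ⟨f'.1, hz', isVertexOfEdge_cap.1 hwf'⟩
    exact (hA.reflTransGen_collapse h (he := he) (heA := heA)).lift id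
      fun _ _ ⟨f, hf, h⟩ => ⟨f, isVertexOfEdge_cap.2 hf, h⟩
  · exact hsc.orientable h3 h1 (boundaryTwo_capChain (he := he) (heA := heA) hc)
      (capChain_ne_zero he heA c hk)

theorem cap_not_isIdentity (he : K.IsTriangle e) (heA : ∀ i, ∃ a ∈ A, K.IsEdge (e i) a)
    (hoff : ∀ a, ∃ f, K.IsEdge f a ∧ f ∉ Set.range e) : ¬ (cap he heA).IsIdentity := by
  rintro ⟨u, u', hne, hall, hface⟩
  have key (a : A) (h : ∀ i : Fin 3, (cap he heA).face i (some a) =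
      (cap he heA).face i none) : False := by
    obtain ⟨f, ⟨i, rfl⟩, hf⟩ := hoff a
    exact hf ⟨i, (congrArg Subtype.val (h i)).symm⟩
  match u, u' with
  | none, none => exact hne rfl
  | some a, none => exact key a hface
  | none, some a => exact key a fun i => (hface i).symm
  -- Here the new 2-cell would be a third one.
  | some a, some b => cases hall none <;> contradiction

end Cap

/-! ### The two sides of a cut-triangle -/

/-- A cut-triangle consists of the edges of a triangle and is the frontier of a set of 2-cells. -/
theorem IsReducible.exists_triangle (hK : K.IsMComplex) (h : K.IsReducible) :
    ∃ (e : Fin 3 → K.cell 1) (A : Set (K.cell 2)), K.IsTriangle e ∧ A.Nonempty ∧ Aᶜ.Nonempty ∧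
      K.FrontierSubset A e ∧ ∀ a, ∃ f, K.IsEdge f a ∧ f ∉ Set.range e := by
  obtain ⟨T, ⟨e₀, e₁, e₂, hT, hb⟩, hequiv, hcard⟩ := h
  obtain ⟨e, he, hrange⟩ : ∃ e, K.IsTriangle e ∧ T = Set.range e := by
    rcases isTriangle_or_of_boundaryOne_eq_zero hK.regular_one hb with h | h
    · refine ⟨_, h, ?_⟩
      rw [hT]
      ext f
      simp [eq_comm]
      tauto
    · refine ⟨_, h, ?_⟩
      rw [hT]
      ext f
      simp [eq_comm]
  subst hrange
  obtain ⟨p, q, hpq, -⟩ := Nat.card_eq_two_iff.1 hcard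
  induction p using Quotient.inductionOn with | _ a
  induction q using Quotient.inductionOn with | _ b
  -- `A` is the class of `a`; the complement is only required to contain `b`, not to be one class.
  refine ⟨e, {z | Relation.TransGen (K.SharesEdgeOff (Set.range e)) a z}, he,
    ⟨a, hequiv.refl a⟩, ⟨b, fun h => hpq (Quotient.sound h)⟩, fun f s t hs ht hsA htA => ?_,
    fun z => ?_⟩
  · by_contra hf
    exact htA (.tail hsA ⟨f, hf, hs, ht⟩)
  -- Reflexivity of the transitive closure means a chain from `z` to itself, whose first step uses
  -- an edge of `z` off the triangle.
  · obtain ⟨_, ⟨f, hf, hz, _⟩, -⟩ := Relation.TransGen.head'_iff.1 (hequiv.refl z)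
    exact ⟨f, hz, hf⟩

/-- The boundary has the nonzero coefficient `± k` at `e i`, so some 2-cell of `A` must contribute
to it. -/
theorem exists_isEdge_of_boundaryTwo_filter
    (h1 : ∀ e : K.cell 1, Function.Injective fun i => K.face i e) {A : Set (K.cell 2)}
    [DecidablePred (· ∈ A)] {e : Fin 3 → K.cell 1} (he : K.IsTriangle e) {c : K.cell 2 →₀ ℤ}
    {k : ℤ} (hk : k ≠ 0) (hc : K.boundaryTwo (c.filter (· ∈ A)) = k • K.triangleChain e)
    (i : Fin 3) : ∃ a ∈ A, K.IsEdge (e i) a := by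
  by_contra! h
  have h0 : K.boundaryTwo (c.filter (· ∈ A)) (e i) = 0 :=
    boundaryTwo_apply_eq_zero fun x hx => Finsupp.filter_apply_neg _ _ fun hxA => h x hxA hx
  rw [hc, Finsupp.smul_apply] at h0
  rcases triangleChain_apply_eq (he.injective h1) i with h | h <;> simp [h] at h0 <;> exact hk h0

/-- If `k` were zero, the restriction of `c` to `A` would be a cycle vanishing outside `A`, hence
zero. Then `c` would vanish on `A`, and so everywhere. -/
theorem exists_smul_ne_zero_eq_boundaryTwo_filter (hK : K.IsMComplex) {A : Set (K.cell 2)}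
    [DecidablePred (· ∈ A)] {e : Fin 3 → K.cell 1} (he : K.IsTriangle e) (hA : A.Nonempty)
    (hA' : Aᶜ.Nonempty) (hfr : K.FrontierSubset A e) {c : K.cell 2 →₀ ℤ}
    (hc : K.boundaryTwo c = 0) (hc0 : c ≠ 0) :
    ∃ k : ℤ, k ≠ 0 ∧ K.boundaryTwo (c.filter (· ∈ A)) = k • K.triangleChain e := by
  obtain ⟨k, hk⟩ := exists_smul_eq_boundaryTwo_filter hK.regular_one he hfr hc
  refine ⟨k, ?_, hk⟩
  rintro rfl
  obtain ⟨a, ha⟩ := hA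
  obtain ⟨b, hb⟩ := hA'
  have h0 := hK.stronglyConnected.eq_zero hK.two_triangles hK.regular_one
    (hk.trans (zero_smul ..)) (Finsupp.filter_apply_neg _ _ hb)
  have := DFunLike.congr_fun h0 a
  rw [Finsupp.filter_apply_pos (· ∈ A) _ ha] at this
  exact hc0 (hK.stronglyConnected.eq_zero hK.two_triangles hK.regular_one hc this)

/-! ### Recovering the complex from its two caps -/

section Glue

variable {A : Set (K.cell 2)} {e : Fin 3 → K.cell 1} (he : K.IsTriangle e)
  (heA : ∀ i, ∃ a ∈ A, K.IsEdge (e i) a) (heA' : ∀ i, ∃ b ∈ Aᶜ, K.IsEdge (e i) b)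

/-- The map from the connected sum of the two capped complexes to `K`, on cells. -/
def glueMap : (n : ℕ) →
    (connectedSum (cap he heA) (cap he heA') (capCell he heA) (capCell he heA')).cell n →
      K.cell n
  | 0 => Quot.lift (Sum.elim Subtype.val Subtype.val) fun _ _ h => by cases h; rfl
  | 1 => Quot.lift (Sum.elim Subtype.val Subtype.val) fun _ _ h => by cases h; rfl
  | 2 => Sum.elim (fun z => match z with | ⟨some a, _⟩ => a.1 | ⟨none, h⟩ => absurd rfl h)
      (fun z => match z with | ⟨some a, _⟩ => a.1 | ⟨none, h⟩ => absurd rfl h)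
  | _ + 3 => fun c => PEmpty.elim c

theorem isomorphic_connectedSum_cap (hK : K.IsMComplex) (hfr : K.FrontierSubset A e) :
    K.Isomorphic
      (connectedSum (cap he heA) (cap he heA') (capCell he heA) (capCell he heA')) := by
  refine Isomorphic.symm ⟨⟨glueMap he heA heA', fun n i c => ?_⟩,
    fun n => ?_⟩
  · match n, c with
    | 0, c =>
      induction c using Quot.inductionOn with | _ c
      rcases c with c | c <;> rfl
    | 1, .inl ⟨some a, _⟩ => rfl
    | 1, .inl ⟨none, h⟩ => exact absurd rfl h
    | 1, .inr ⟨some a, _⟩ => rfl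
    | 1, .inr ⟨none, h⟩ => exact absurd rfl h
    | _ + 2, c => exact PEmpty.elim c
  match n with
  | 0 =>
    have cross (w : (cap he heA).cell 0) (w' : (cap he heA').cell 0) (h : w.1 = w'.1) :
        Quot.mk (VertexGlue _ _ (capCell he heA) (capCell he heA')) (.inl w) =
          Quot.mk _ (.inr w') := by
      obtain ⟨a, ha, hwa⟩ := w.2
      obtain ⟨b, hb, hwb⟩ := w'.2
      -- A linking sequence around the common vertex leaves `A` across an edge having that vertex.
      -- This edge belongs to the triangle, so the vertex is one of those identified by the gluing.
      obtain ⟨s, t, hs, ht, f, ⟨i, hi⟩, hfs, hft⟩ :=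
        (hK.linked w.1 a b hwa (h ▸ hwb)).exists_crossing ha hb
      obtain ⟨j, rfl⟩ := hfr f s t hfs hft hs ht
      convert Quot.sound (VertexGlue.mk (X := cap he heA) (Y := cap he heA')
        (x := capCell he heA) (y := capCell he heA') i j) using 3
      · exact Subtype.ext hi.symm
      · exact Subtype.ext (h.symm.trans hi.symm)
    refine ⟨fun c d h => ?_, fun w => ?_⟩
    · induction c using Quot.inductionOn with | _ c
      induction d using Quot.inductionOn with | _ d
      rcases c with c | c <;> rcases d with d | d
      · exact congrArg (fun v => Quot.mk _ (Sum.inl v)) (Subtype.ext h)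
      · exact cross c d h
      · exact (cross d c h.symm).symm
      · exact congrArg (fun v => Quot.mk _ (Sum.inr v)) (Subtype.ext h)
    · obtain ⟨f, hf⟩ := hK.exists_edge w
      obtain ⟨a, ha⟩ := hK.exists_triangle f
      by_cases haA : a ∈ A
      · exact ⟨Quot.mk _ (.inl ⟨w, a, haA, f, ha, hf⟩), rfl⟩
      · exact ⟨Quot.mk _ (.inr ⟨w, a, haA, f, ha, hf⟩), rfl⟩
  | 1 =>
    have cross (f : (cap he heA).cell 1) (f' : (cap he heA').cell 1) (h : f.1 = f'.1) :
        Quot.mk (EdgeGlue _ _ (capCell he heA) (capCell he heA')) (.inl f) =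
          Quot.mk _ (.inr f') := by
      obtain ⟨a, ha, hfa⟩ := f.2
      obtain ⟨b, hb, hfb⟩ := f'.2
      obtain ⟨j, hj⟩ := hfr f.1 a b hfa (h ▸ hfb) ha hb
      convert Quot.sound (EdgeGlue.mk (X := cap he heA) (Y := cap he heA')
        (x := capCell he heA) (y := capCell he heA') j) using 3
      · exact Subtype.ext hj.symm
      · exact Subtype.ext (h.symm.trans hj.symm)
    refine ⟨fun c d h => ?_, fun f => ?_⟩
    · induction c using Quot.inductionOn with | _ c
      induction d using Quot.inductionOn with | _ d
      rcases c with c | c <;> rcases d with d | d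
      · exact congrArg (fun v => Quot.mk _ (Sum.inl v)) (Subtype.ext h)
      · exact cross c d h
      · exact (cross d c h.symm).symm
      · exact congrArg (fun v => Quot.mk _ (Sum.inr v)) (Subtype.ext h)
    · obtain ⟨a, ha⟩ := hK.exists_triangle f
      by_cases haA : a ∈ A
      · exact ⟨Quot.mk _ (.inl ⟨f, a, haA, ha⟩), rfl⟩
      · exact ⟨Quot.mk _ (.inr ⟨f, a, haA, ha⟩), rfl⟩
  | 2 =>
    refine ⟨fun c d h => ?_, fun a => ?_⟩
    · match c, d with
      | .inl ⟨none, h⟩, _ => exact absurd rfl h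
      | .inr ⟨none, h⟩, _ => exact absurd rfl h
      | _, .inl ⟨none, h⟩ => exact absurd rfl h
      | _, .inr ⟨none, h⟩ => exact absurd rfl h
      | .inl ⟨some a, _⟩, .inl ⟨some b, _⟩ =>
        exact congrArg Sum.inl (Subtype.ext (congrArg some (Subtype.ext h)))
      | .inr ⟨some a, _⟩, .inr ⟨some b, _⟩ =>
        exact congrArg Sum.inr (Subtype.ext (congrArg some (Subtype.ext h)))
      | .inl ⟨some a, _⟩, .inr ⟨some b, _⟩ => exact absurd ((show a.1 = b.1 from h) ▸ a.2) b.2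
      | .inr ⟨some a, _⟩, .inl ⟨some b, _⟩ => exact absurd ((show a.1 = b.1 from h) ▸ b.2) a.2
    · by_cases haA : a ∈ A
      · exact ⟨.inl ⟨some ⟨a, haA⟩, Option.some_ne_none _⟩, rfl⟩
      · exact ⟨.inr ⟨some ⟨a, haA⟩, Option.some_ne_none _⟩, rfl⟩
  | m + 3 =>
    have := hK.empty_of_three_le (m + 3) (by omega)
    exact ⟨fun c => PEmpty.elim c, fun a => isEmptyElim a⟩

end Glue

/-! ### Reducible complexes are decomposable -/

theorem IsReducible.isDecomposable (hK : K.IsMComplex) (h : K.IsReducible) :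
    K.IsDecomposable := by
  classical
  obtain ⟨e, A, he, hA, hA', hfr, hoff⟩ := h.exists_triangle hK
  obtain ⟨c, hc, hc0⟩ := exists_cycle_of_orientable hK.orientable
  obtain ⟨k, hk, hck⟩ := exists_smul_ne_zero_eq_boundaryTwo_filter hK he hA hA' hfr hc hc0
  obtain ⟨k', hk', hck'⟩ := exists_smul_ne_zero_eq_boundaryTwo_filter hK he hA'
    (by rwa [compl_compl]) hfr.compl hc hc0
  have heA := exists_isEdge_of_boundaryTwo_filter hK.regular_one he hk hck
  have heA' := exists_isEdge_of_boundaryTwo_filter hK.regular_one he hk' hck'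
  exact ⟨cap he heA, cap he heA', capCell he heA, capCell he heA',
    ⟨cap_isMComplex hK he heA heA' hfr hk hck, cap_not_isIdentity he heA hoff⟩,
    ⟨cap_isMComplex hK he heA' (fun i => (heA i).imp fun a h => ⟨not_not.2 h.1, h.2⟩)
      hfr.compl hk' hck', cap_not_isIdentity he heA' hoff⟩,
    isomorphic_connectedSum_cap he heA heA' hK hfr⟩

end DeltaComplex

theorem mainTheorem4 (K : DeltaComplex.{u}) (hK : K.IsMComplex) :
    K.IsReducible ↔ K.IsDecomposable :=
  ⟨fun h => h.isDecomposable hK, fun h => h.isReducible⟩
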